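/- Let $\{\zeta_i\}_{i\ge 1}$ be the points of a Poisson process on $(0,\infty)$ with intensity measure $\zeta^{-2}\,d\zeta$ and let $Y_1,Y_2,\dots$ be, independently of $\{\zeta_i\}$, independent copies of a non-negative stochastic process $Y$ on a set $\mathcal X$ with $\mathbb E\{Y(s)\}=1$ for all $s\in\mathcal X$. Put $\varphi_i(s)=\zeta_iY_i(s)$ and $M(s)=\max_{i\ge 1}\varphi_i(s)$, and for $s_1,s_2\in\mathcal X$ let $$p(s_1,s_2)=\mathbb P\{\text{for some }\ell\ge 1:\ M(s_1)=\varphi_\ell(s_1)\text{ and }M(s_2)=\varphi_\ell(s_2)\}$$ be the extremal concurrence probability. Let $\eta=\{\eta(s)\}_{s\in\mathcal X}$ be any max-stable process with this spectral representation, that is, either $\eta$ has the same finite-dimensional distributions as $M$ (a simple max-stable process), or, for general margins, $\eta$ has the same finite-dimensional distributions as $\{h_s(M(s))\}_{s\in\mathcal X}$ for some strictly increasing functions $h_s:(0,\infty)\to\mathbb R$ (the result holds for any such $h_s$, whether or not the margins are extreme value distributions). Then, for all $s_1,s_2\in\mathcal X$, $$p(s_1,s_2)=\tau,\qquad \tau=\mathbb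 E\left[\operatorname{sign}\{\eta(s_1)-\eta_*(s_1)\}\,\operatorname{sign}\{\eta(s_2)-\eta_*(s_2)\}\right],$$ where $\eta_*$ is an independent copy of $\eta$; that is, $p(s_1,s_2)$ is Kendall's $\tau$ of the pair $(\eta(s_1),\eta(s_2))$. -/

import Mathlib

open MeasureTheory ProbabilityTheory Set
open scoped ENNReal

/-- The random counting measure `∑ i, δ_{x i}` of a sequence of random points. -/
noncomputable def pointMeasure {Ω E : Type*} [MeasurableSpace E] (x : ℕ → Ω → E) (ω : Ω) :
    Measure E :=
  Measure.sum fun i => Measure.dirac (x i ω)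

/-- The random points `x 0, x 1, …` are the points of a Poisson point process with intensity
measure `Λ`: the number of points in `B` is Poisson with mean `Λ B` (almost surely infinite
if `Λ B = ∞`), and the numbers of points in pairwise disjoint sets are independent. -/
structure IsPoissonPointProcess {Ω E : Type*} [MeasurableSpace Ω] [MeasurableSpace E]
    (P : Measure Ω) (x : ℕ → Ω → E) (Λ : Measure E) : Prop where
  measurable : ∀ i, Measurable (x i)
  map_count : ∀ B, MeasurableSet B → Λ B ≠ ∞ →
    P.map (fun ω => pointMeasure x ω B) =
      (poissonMeasure (Λ B).toNNReal).map (fun n : ℕ => (n : ℝ≥0∞))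
  count_eq_top : ∀ B, MeasurableSet B → Λ B = ∞ → ∀ᵐ ω ∂P, pointMeasure x ω B = ∞
  indep_count : ∀ (n : ℕ) (B : Fin n → Set E), (∀ j, MeasurableSet (B j)) →
    Pairwise (fun j k => Disjoint (B j) (B k)) →
    iIndepFun (fun j ω => pointMeasure x ω (B j)) P

/-- The measure `ζ⁻² dζ` on `(0, ∞)`. -/
noncomputable def frechetIntensity : Measure ℝ :=
  (volume.restrict (Ioi 0)).withDensity fun x => ENNReal.ofReal ((x ^ 2)⁻¹)

/-- The data of a spectral representation `s ↦ max_i ζ_i Y_i(s)`: the `ζ_i` are the points of a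
Poisson process on `(0, ∞)` with intensity `ζ⁻² dζ`, and the `Y_i` are, independently of the
`ζ_i`, independent copies of a nonnegative process on `T` with mean one at every `s : T`.
(An integral equal to `1` is that of an integrable function.) -/
structure IsSpectralData {T Ω : Type*} [MeasurableSpace Ω] (P : Measure Ω)
    (ζ : ℕ → Ω → ℝ) (Y : ℕ → T → Ω → ℝ) : Prop where
  poisson : IsPoissonPointProcess P ζ frechetIntensity
  pos : ∀ i ω, 0 < ζ i ω
  measurable : ∀ i s, Measurable (Y i s)
  nonneg : ∀ i s ω, 0 ≤ Y i s ω
  mean_one : ∀ i s, ∫ ω, Y i s ω ∂P = 1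
  indep : iIndepFun (fun i ω s => Y i s ω) P
  identDistrib : ∀ i, IdentDistrib (fun ω s => Y i s ω) (fun ω s => Y 0 s ω) P P
  indep_points : IndepFun (fun ω i => ζ i ω) (fun ω i s => Y i s ω) P

/-- The functions `φ_i = ζ_i Y_i` of the spectral representation. -/
def spectralFun {T Ω : Type*} (ζ : ℕ → Ω → ℝ) (Y : ℕ → T → Ω → ℝ) (i : ℕ) (s : T) (ω : Ω) : ℝ :=
  ζ i ω * Y i s ω

/-- The simple max-stable process `s ↦ max_i φ_i(s)`. -/
noncomputable def spectralMax {T Ω : Type*} (ζ : ℕ → Ω → ℝ) (Y : ℕ → T → Ω → ℝ)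
    (s : T) (ω : Ω) : ℝ :=
  ⨆ i, spectralFun ζ Y i s ω

/-- The process `η` has the spectral representation `(ζ, Y)`: up to strictly increasing
transformations `h s` of its margins, it has the finite-dimensional distributions of the
process `s ↦ max_i ζ_i Y_i(s)`. The margins of the latter are unit Fréchet, carried by `(0, ∞)`;
`h s = id` is the case of a simple max-stable process `η`. -/
structure HasSpectralRepresentation {T Ω Ω' : Type*} [MeasurableSpace Ω] [MeasurableSpace Ω']
    (P' : Measure Ω') (η : T → Ω' → ℝ)
    (P : Measure Ω) (ζ : ℕ → Ω → ℝ) (Y : ℕ → T → Ω → ℝ) : Prop where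
  data : IsSpectralData P ζ Y
  law : ∃ h : T → ℝ → ℝ, (∀ s, StrictMonoOn (h s) (Ioi 0)) ∧
    ∀ I : Finset T, IdentDistrib (fun ω (s : I) => η s ω)
      (fun ω (s : I) => h s (spectralMax ζ Y s ω)) P' P

/-- The extremal concurrence probability `p(s_1, …, s_k)`: the probability that a single
function `φ_ℓ` attains the maximum at all the points `s_1, …, s_k`. -/
noncomputable def extremalConcurrenceProb {T Ω : Type*} [MeasurableSpace Ω] (P : Measure Ω)
    (ζ : ℕ → Ω → ℝ) (Y : ℕ → T → Ω → ℝ) {k : ℕ} (s : Fin k → T) : ℝ :=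
  P.real {ω | ∃ l, ∀ j, spectralMax ζ Y (s j) ω = spectralFun ζ Y l (s j) ω}

/-- Kendall's tau of a pair of random variables,
`E[sign(U - U_*) sign(V - V_*)]` with `(U_*, V_*)` an independent copy of `(U, V)`,
realized on the product space. -/
noncomputable def kendallTau {Ω : Type*} [MeasurableSpace Ω] (P : Measure Ω) (U V : Ω → ℝ) : ℝ :=
  ∫ z, Real.sign (U z.1 - U z.2) * Real.sign (V z.1 - V z.2) ∂(P.prod P)

/-! Toss an independent fair coin for each `φ_i`, and at each site take the maximum over the heads
and the maximum over the tails. Thinning a Poisson process by coins yields two independent processes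
of half the intensity, and the exponent of the max-stable law is homogeneous of degree -1. So the
pair of thinned maxima at two sites is distributed as two independent copies of `M / 2`
(`map_thinnedMax`). Signs are unchanged by halving, so Kendall's tau is the expected product of the
signs of "heads maximum minus tails maximum" at the two sites.

Now fix the `φ_i` and average over the coins. At each site the sign is the coin of the function
attaining the overall maximum there. Two coins are orthogonal unless they are the same coin, so the
average is 1 if one function attains both maxima and 0 otherwise (`integral_sign_coinSup`).
Integrating over the `φ_i` gives the concurrence probability.

The analytic input is the avoidance function of a marked Poisson process (`measure_forall_le_one`),
derived from the Laplace functional. Strictly increasing changes of margins do not affect the signs.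
-/

open Filter
open scoped NNReal Topology

/-! ### Exponentials on `[0, ∞]` and the Poisson distribution -/

/-- The function `x ↦ exp (-x)` on `[0, ∞]`. -/
noncomputable def expNeg (x : ℝ≥0∞) : ℝ≥0∞ := (EReal.exp (x : EReal))⁻¹

@[simp] lemma expNeg_zero : expNeg 0 = 1 := by simp [expNeg]

@[simp] lemma expNeg_top : expNeg ∞ = 0 := by simp [expNeg]

lemma expNeg_add (x y : ℝ≥0∞) : expNeg (x + y) = expNeg x * expNeg y := by
  have h (z : ℝ≥0∞) : EReal.exp (z : EReal) ≠ 0 := by simp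
  rw [expNeg, EReal.coe_ennreal_add, EReal.exp_add,
    ENNReal.mul_inv (Or.inl (h x)) (Or.inr (h y)), expNeg, expNeg]

lemma expNeg_sum {ι : Type*} (s : Finset ι) (f : ι → ℝ≥0∞) :
    expNeg (∑ i ∈ s, f i) = ∏ i ∈ s, expNeg (f i) := by
  classical
  induction s using Finset.induction_on with
  | empty => simp
  | insert a s ha ih => rw [Finset.sum_insert ha, Finset.prod_insert ha, expNeg_add, ih]

lemma expNeg_antitone : Antitone expNeg := fun x y h => by
  unfold expNeg
  exact ENNReal.inv_le_inv.2 (EReal.exp_monotone (by simpa using h))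

/-- Continuity at `∞` is included, so limits of Laplace functionals need no finiteness of the
exponents. -/
lemma continuous_expNeg : Continuous expNeg :=
  continuous_inv.comp (ENNReal.continuous_exp.comp continuous_coe_ennreal_ereal)

lemma measurable_expNeg : Measurable expNeg := continuous_expNeg.measurable

lemma expNeg_le_one (x : ℝ≥0∞) : expNeg x ≤ 1 := by
  simpa using expNeg_antitone (zero_le (a := x))

lemma expNeg_ofReal {x : ℝ} (hx : 0 ≤ x) : expNeg (ENNReal.ofReal x) =
    ENNReal.ofReal (Real.exp (-x)) := by
  rw [expNeg, EReal.coe_ennreal_ofReal, max_eq_left hx, EReal.exp_coe, Real.exp_neg,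
    ENNReal.ofReal_inv_of_pos (Real.exp_pos x)]

lemma expNeg_mul_nat (c : ℝ≥0∞) (n : ℕ) : expNeg (c * n) = expNeg c ^ n := by
  induction n with
  | zero => simp
  | succ n ih => rw [Nat.cast_succ, mul_add, expNeg_add, ih, mul_one, pow_succ]

/-- The function `x ↦ -log x` on `[0, 1]`. -/
noncomputable def negLog (x : ℝ≥0∞) : ℝ≥0∞ := (ENNReal.log x⁻¹).toENNReal

lemma measurable_negLog : Measurable negLog :=
  measurable_ereal_toENNReal.comp (ENNReal.measurable_log.comp measurable_inv)

lemma expNeg_negLog {x : ℝ≥0∞} (hx : x ≤ 1) : expNeg (negLog x) = x := by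
  have : 0 ≤ ENNReal.log x⁻¹ := by simpa using hx
  rw [expNeg, negLog, EReal.coe_toENNReal this, ENNReal.exp_log, inv_inv]

lemma lintegral_poissonMeasure (r : ℝ≥0) (f : ℕ → ℝ≥0∞) :
    ∫⁻ n, f n ∂poissonMeasure r =
      ∑' n, ENNReal.ofReal (Real.exp (-r) * r ^ n / n.factorial) * f n := by
  rw [poissonMeasure, lintegral_sum_measure]
  simp

/-- With `q = expNeg c`, this is the exponential series at `r * q`; `c = ∞` corresponds to `q = 0`.
-/
lemma lintegral_expNeg_poissonMeasure (r : ℝ≥0) (c : ℝ≥0∞) :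
    ∫⁻ n : ℕ, expNeg (c * n) ∂poissonMeasure r = expNeg ((1 - expNeg c) * r) := by
  obtain ⟨q, hq0, hq1, hq⟩ : ∃ q : ℝ, 0 ≤ q ∧ q ≤ 1 ∧ expNeg c = ENNReal.ofReal q := by
    refine ⟨(expNeg c).toReal, ENNReal.toReal_nonneg, ?_, ?_⟩
    · simpa using ENNReal.toReal_mono ENNReal.one_ne_top (expNeg_le_one c)
    · rw [ENNReal.ofReal_toReal (ne_top_of_le_ne_top ENNReal.one_ne_top (expNeg_le_one c))]
  have hs : HasSum (fun n : ℕ => Real.exp (-r) * ((r * q) ^ n / n.factorial))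
      (Real.exp (-r) * Real.exp (r * q)) := by
    refine HasSum.mul_left _ ?_
    rw [Real.exp_eq_exp_ℝ]
    exact NormedSpace.expSeries_div_hasSum_exp (r * q : ℝ)
  have hr : (1 - expNeg c) * r = ENNReal.ofReal ((1 - q) * r) := by
    rw [hq, ← ENNReal.ofReal_one, ← ENNReal.ofReal_sub _ hq0, ENNReal.ofReal_mul (by linarith)]
    simp
  rw [lintegral_poissonMeasure, hr, expNeg_ofReal (mul_nonneg (sub_nonneg.2 hq1) r.coe_nonneg),
    show -((1 - q) * (r : ℝ)) = -r + r * q by ring, Real.exp_add, ← hs.tsum_eq,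
    ENNReal.ofReal_tsum_of_nonneg (fun n => by positivity) hs.summable]
  refine tsum_congr fun n => ?_
  rw [expNeg_mul_nat, hq, ← ENNReal.ofReal_pow hq0, ← ENNReal.ofReal_mul (by positivity)]
  congr 1
  ring

lemma lintegral_natCast_poissonMeasure (r : ℝ≥0) :
    ∫⁻ n : ℕ, (n : ℝ≥0∞) ∂poissonMeasure r = r := by
  have h1 : ∑' n : ℕ, ENNReal.ofReal (Real.exp (-r) * r ^ n / n.factorial) = 1 := by
    have := lintegral_poissonMeasure r fun _ => 1
    simpa using this.symm
  rw [lintegral_poissonMeasure, tsum_eq_zero_add' ENNReal.summable]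
  calc _ = ∑' n : ℕ, (r : ℝ≥0∞) * ENNReal.ofReal (Real.exp (-r) * r ^ n / n.factorial) := by
        rw [Nat.cast_zero, mul_zero, zero_add]
        refine tsum_congr fun n => ?_
        rw [← ENNReal.ofReal_natCast, ← ENNReal.ofReal_mul (by positivity),
          ← ENNReal.ofReal_coe_nnreal, ← ENNReal.ofReal_mul (by positivity)]
        congr 1
        rw [Nat.factorial_succ]
        push_cast
        field_simp
        ring
    _ = r := by rw [ENNReal.tsum_mul_left, h1, mul_one]

/-! ### Campbell's formula and the Laplace functional -/

namespace IsPoissonPointProcess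

variable {Ω E : Type*} [MeasurableSpace Ω] [MeasurableSpace E] {P : Measure Ω}
  {x : ℕ → Ω → E} {Λ : Measure E}

lemma measurable_count (hx : IsPoissonPointProcess P x Λ) {B : Set E} (hB : MeasurableSet B) :
    Measurable fun ω => pointMeasure x ω B := by
  have h : (fun ω => pointMeasure x ω B) = fun ω => ∑' i, B.indicator 1 (x i ω) := by
    ext ω
    simp [pointMeasure, Measure.sum_apply _ hB, Measure.dirac_apply' _ hB]
  rw [h]
  exact Measurable.tsum fun i => (measurable_one.indicator hB).comp (hx.measurable i)

lemma lintegral_expNeg_count [IsProbabilityMeasure P] (hx : IsPoissonPointProcess P x Λ)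
    {B : Set E} (hB : MeasurableSet B) (c : ℝ≥0∞) :
    ∫⁻ ω, expNeg (c * pointMeasure x ω B) ∂P = expNeg ((1 - expNeg c) * Λ B) := by
  by_cases hΛ : Λ B = ∞
  · rcases eq_or_ne c 0 with rfl | hc
    · simp
    have h1 : expNeg c < 1 := by
      simpa [expNeg] using pos_iff_ne_zero.2 hc
    rw [hΛ, ENNReal.mul_top (tsub_pos_of_lt h1).ne', expNeg_top, lintegral_eq_zero_iff]
    · filter_upwards [hx.count_eq_top B hB hΛ] with ω hω
      simp [hω, ENNReal.mul_top hc]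
    · exact measurable_expNeg.comp ((hx.measurable_count hB).const_mul c)
  · have h := lintegral_map (μ := P) (f := fun y : ℝ≥0∞ => expNeg (c * y))
      (measurable_expNeg.comp (measurable_const_mul c)) (hx.measurable_count hB)
    rw [← h, hx.map_count B hB hΛ, lintegral_map (f := fun y : ℝ≥0∞ => expNeg (c * y))
      (measurable_expNeg.comp (measurable_const_mul c)) (measurable_of_countable _),
      lintegral_expNeg_poissonMeasure, ENNReal.coe_toNNReal hΛ]

lemma lintegral_count (hx : IsPoissonPointProcess P x Λ) [IsProbabilityMeasure P]
    {B : Set E} (hB : MeasurableSet B) : ∫⁻ ω, pointMeasure x ω B ∂P = Λ B := by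
  by_cases hΛ : Λ B = ∞
  · rw [lintegral_congr_ae (hx.count_eq_top B hB hΛ)]
    simp [hΛ]
  · have h := lintegral_map (μ := P) (f := fun y : ℝ≥0∞ => y) measurable_id (hx.measurable_count hB)
    rw [← h, hx.map_count B hB hΛ, lintegral_map (f := fun y : ℝ≥0∞ => y) measurable_id
      (measurable_of_countable _), lintegral_natCast_poissonMeasure, ENNReal.coe_toNNReal hΛ]

/-- Campbell's formula. -/
lemma lintegral_tsum (hx : IsPoissonPointProcess P x Λ) [IsProbabilityMeasure P]
    {f : E → ℝ≥0∞} (hf : Measurable f) :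
    ∑' i, ∫⁻ ω, f (x i ω) ∂P = ∫⁻ t, f t ∂Λ := by
  -- The laws of the individual points add up to the mean counting measure.
  have h : Measure.sum (fun i => P.map (x i)) = Λ := by
    ext B hB
    rw [Measure.sum_apply _ hB, ← hx.lintegral_count hB]
    simp only [pointMeasure, Measure.sum_apply _ hB]
    rw [MeasureTheory.lintegral_tsum]
    · refine tsum_congr fun i => ?_
      rw [Measure.map_apply (hx.measurable i) hB, ← lintegral_indicator_one (hx.measurable i hB)]
      refine lintegral_congr fun ω => ?_
      rw [Measure.dirac_apply' _ hB]
      rfl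
    · intro i
      simp_rw [Measure.dirac_apply' _ hB]
      exact ((measurable_one.indicator hB).comp (hx.measurable i)).aemeasurable
  rw [← h, lintegral_sum_measure]
  exact tsum_congr fun i => (lintegral_map hf (hx.measurable i)).symm

omit [MeasurableSpace Ω] in
lemma lintegral_pointMeasure (x : ℕ → Ω → E) {f : E → ℝ≥0∞} (hf : Measurable f) (ω : Ω) :
    ∫⁻ t, f t ∂pointMeasure x ω = ∑' i, f (x i ω) := by
  rw [pointMeasure, lintegral_sum_measure]
  exact tsum_congr fun i => lintegral_dirac' _ hf

/-- The counts on the level sets of `f` are independent, so the expectation factors into Poisson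
Laplace transforms. -/
lemma laplace_simpleFunc (hx : IsPoissonPointProcess P x Λ) [IsProbabilityMeasure P]
    (f : SimpleFunc E ℝ≥0∞) :
    ∫⁻ ω, expNeg (∫⁻ t, f t ∂pointMeasure x ω) ∂P = expNeg (∫⁻ t, (1 - expNeg (f t)) ∂Λ) := by
  let e := f.range.equivFin
  let c : Fin f.range.card → ℝ≥0∞ := fun j => (e.symm j : ℝ≥0∞)
  let B : Fin f.range.card → Set E := fun j => f ⁻¹' {c j}
  have hB : ∀ j, MeasurableSet (B j) := fun j => f.measurableSet_fiber _
  have hsum : ∀ F : ℝ≥0∞ → ℝ≥0∞, ∑ r ∈ f.range, F r = ∑ j, F (c j) := fun F => by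
    rw [← Finset.sum_coe_sort, ← e.symm.sum_comp]
  have hind := hx.indep_count _ B hB (fun j k hjk => by
    refine Disjoint.preimage _ (Set.disjoint_singleton.2 fun h => hjk ?_)
    exact e.symm.injective (Subtype.ext h))
  have hL (μ : Measure E) : ∫⁻ t, f t ∂μ = ∑ j, c j * μ (B j) := by
    rw [f.lintegral_eq_lintegral, SimpleFunc.lintegral, hsum fun r => r * μ (f ⁻¹' {r})]
  have hR : ∫⁻ t, (1 - expNeg (f t)) ∂Λ = ∑ j, (1 - expNeg (c j)) * Λ (B j) := by
    have := (f.map fun r => 1 - expNeg r).lintegral_eq_lintegral Λ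
    rw [SimpleFunc.map_lintegral, hsum fun r => (1 - expNeg r) * Λ (f ⁻¹' {r})] at this
    simpa using this
  simp_rw [hL, hR, expNeg_sum]
  have hg (j) : Measurable fun y : ℝ≥0∞ => expNeg (c j * y) :=
    measurable_expNeg.comp (measurable_const_mul _)
  have := lintegral_prod_eq_prod_lintegral_of_indepFun (μ := P) Finset.univ
    (fun j ω => expNeg (c j * pointMeasure x ω (B j)))
    (hind.comp (fun j y => expNeg (c j * y)) hg) (fun j => (hg j).comp (hx.measurable_count (hB j)))
  rw [this]
  exact Finset.prod_congr rfl fun j _ => hx.lintegral_expNeg_count (hB j) _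

/-- The Laplace functional of a Poisson process. -/
lemma laplace (hx : IsPoissonPointProcess P x Λ) [IsProbabilityMeasure P]
    {f : E → ℝ≥0∞} (hf : Measurable f) :
    ∫⁻ ω, expNeg (∑' i, f (x i ω)) ∂P = expNeg (∫⁻ t, (1 - expNeg (f t)) ∂Λ) := by
  simp_rw [← lintegral_pointMeasure x hf]
  have hm (g : SimpleFunc E ℝ≥0∞) : Measurable fun ω => ∫⁻ t, g t ∂pointMeasure x ω := by
    simp_rw [lintegral_pointMeasure x g.measurable]
    exact Measurable.tsum fun i => g.measurable.comp (hx.measurable i)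
  -- Simple functions increase to `f`: the expectation converges by domination by 1, the exponent on
  -- the right by monotone convergence.
  have h1 : Tendsto (fun n => ∫⁻ ω, expNeg (∫⁻ t, SimpleFunc.eapprox f n t ∂pointMeasure x ω) ∂P)
      atTop (𝓝 (∫⁻ ω, expNeg (∫⁻ t, f t ∂pointMeasure x ω) ∂P)) := by
    refine tendsto_lintegral_of_dominated_convergence (fun _ => 1)
      (fun n => measurable_expNeg.comp (hm _)) (fun n => ae_of_all _ fun ω => expNeg_le_one _)
      (by simp) (ae_of_all _ fun ω => ?_)
    refine (continuous_expNeg.tendsto _).comp ?_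
    refine lintegral_tendsto_of_tendsto_of_monotone
      (fun n => (SimpleFunc.measurable _).aemeasurable)
      (ae_of_all _ fun t n m h => SimpleFunc.monotone_eapprox f h t)
      (ae_of_all _ fun t => SimpleFunc.tendsto_eapprox hf t)
  have h2 : Tendsto (fun n => expNeg (∫⁻ t, (1 - expNeg (SimpleFunc.eapprox f n t)) ∂Λ))
      atTop (𝓝 (expNeg (∫⁻ t, (1 - expNeg (f t)) ∂Λ))) := by
    refine (continuous_expNeg.tendsto _).comp ?_
    refine lintegral_tendsto_of_tendsto_of_monotone
      (fun n => ((measurable_expNeg.comp (SimpleFunc.measurable _)).const_sub 1).aemeasurable)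
      (ae_of_all _ fun t n m h => tsub_le_tsub_left
        (expNeg_antitone (SimpleFunc.monotone_eapprox f h t)) _)
      (ae_of_all _ fun t => ?_)
    exact ENNReal.Tendsto.sub tendsto_const_nhds
      ((continuous_expNeg.tendsto _).comp (SimpleFunc.tendsto_eapprox hf t)) (Or.inl (by simp))
  simp_rw [hx.laplace_simpleFunc] at h1
  exact tendsto_nhds_unique h1 h2

end IsPoissonPointProcess

/-! ### The intensity `ζ⁻² dζ` and independent marks -/

lemma frechetIntensity_Ioi {c : ℝ} (hc : 0 < c) :
    frechetIntensity (Ioi c) = ENNReal.ofReal c⁻¹ := by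
  rw [frechetIntensity, withDensity_apply _ measurableSet_Ioi,
    Measure.restrict_restrict measurableSet_Ioi, inter_eq_left.2 (Ioi_subset_Ioi hc.le)]
  have h : EqOn (fun x : ℝ => (x ^ 2)⁻¹) (fun x => x ^ (-2 : ℝ)) (Ioi c) := fun x hx => by
    have : 0 < x := hc.trans hx
    simp only
    rw [Real.rpow_neg this.le, Real.rpow_two]
  have hi := (integrableOn_Ioi_rpow_of_lt (a := -2) (by norm_num) hc).congr_fun h.symm
    measurableSet_Ioi
  rw [← ofReal_integral_eq_lintegral_ofReal hi (ae_of_all _ fun x => by positivity),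
    setIntegral_congr_fun measurableSet_Ioi h, integral_Ioi_rpow_of_lt (by norm_num) hc]
  norm_num [Real.rpow_neg_one]

instance : SFinite frechetIntensity := by
  unfold frechetIntensity
  infer_instance

/-- The tail beyond `1 / k` has mass `k`. The value `k = ∞` is needed because `maxRatio` is infinite
where a positive number is divided by a zero threshold. -/
lemma frechetIntensity_one_lt_mul (k : ℝ≥0∞) :
    frechetIntensity {t | 1 < ENNReal.ofReal t * k} = k := by
  have hfin {r : ℝ} (hr : 0 < r) : {t | 1 < ENNReal.ofReal t * ENNReal.ofReal r} = Ioi r⁻¹ := by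
    ext t
    rw [mem_ofPred_eq, mem_Ioi, ← ENNReal.ofReal_mul' hr.le, ENNReal.one_lt_ofReal,
      inv_lt_iff_one_lt_mul₀ hr, mul_comm]
  rcases eq_or_ne k 0 with rfl | h0
  · simp
  by_cases htop : k = ∞
  · subst htop
    refine eq_top_iff.2 (ENNReal.le_of_forall_nnreal_lt fun r _ => ?_)
    -- Adding 1 keeps the factor positive when `r = 0`.
    have hr : (0 : ℝ) < r + 1 := by positivity
    have h1 : frechetIntensity {t | 1 < ENNReal.ofReal t * ENNReal.ofReal (r + 1)} =
        ENNReal.ofReal (r + 1) := by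
      rw [hfin hr, frechetIntensity_Ioi (inv_pos.2 hr), inv_inv]
    have h2 : (r : ℝ≥0∞) ≤ ENNReal.ofReal (r + 1) := by
      rw [← ENNReal.ofReal_coe_nnreal]
      exact ENNReal.ofReal_le_ofReal (by linarith)
    refine h2.trans (h1.symm.trans_le (measure_mono fun t ht => ?_))
    rw [mem_ofPred_eq] at ht ⊢
    exact lt_of_lt_of_le ht (mul_le_mul_right le_top _)
  · have hk := ENNReal.toReal_pos h0 htop
    rw [← ENNReal.ofReal_toReal htop, hfin hk, frechetIntensity_Ioi (inv_pos.2 hk), inv_inv]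

/-- The `Z i` are marks of the points `ζ i`: independent of the points, they are independent
with common law `ν`. -/
structure IsIndepMarking {Ω E : Type*} [MeasurableSpace Ω] [MeasurableSpace E] (P : Measure Ω)
    (ζ : ℕ → Ω → ℝ) (Z : ℕ → Ω → E) (ν : Measure E) : Prop where
  measurable : ∀ i, Measurable (Z i)
  indep : iIndepFun Z P
  map_eq : ∀ i, P.map (Z i) = ν
  indep_points : IndepFun (fun ω i => ζ i ω) (fun ω i => Z i ω) P

namespace IsIndepMarking

variable {Ω E F : Type*} [MeasurableSpace Ω] [MeasurableSpace E] [MeasurableSpace F]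
  {P : Measure Ω} [IsProbabilityMeasure P] {ζ : ℕ → Ω → ℝ} {Z : ℕ → Ω → E} {ν : Measure E}

lemma isProbabilityMeasure (hZ : IsIndepMarking P ζ Z ν) : IsProbabilityMeasure ν := by
  rw [← hZ.map_eq 0]
  exact Measure.isProbabilityMeasure_map (hZ.measurable 0).aemeasurable

/-- Once the points are frozen by Tonelli, the marks are still independent and the product factors.
-/
lemma lintegral_prod_range (hZ : IsIndepMarking P ζ Z ν) (hζ : ∀ i, Measurable (ζ i))
    {G : ℝ → E → ℝ≥0∞} (hG : Measurable (Function.uncurry G)) (N : ℕ) :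
    ∫⁻ ω, ∏ i ∈ Finset.range N, G (ζ i ω) (Z i ω) ∂P =
      ∫⁻ ω, ∏ i ∈ Finset.range N, ∫⁻ z, G (ζ i ω) z ∂ν ∂P := by
  have := hZ.isProbabilityMeasure
  have hζ' : Measurable fun ω i => ζ i ω := measurable_pi_lambda _ hζ
  have hZ' : Measurable fun ω i => Z i ω := measurable_pi_lambda _ hZ.measurable
  have hmap := (indepFun_iff_map_prod_eq_prod_map_map hζ'.aemeasurable
    hZ'.aemeasurable).1 hZ.indep_points
  have hm : Measurable fun p : (ℕ → ℝ) × (ℕ → E) =>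
      ∏ i ∈ Finset.range N, G (p.1 i) (p.2 i) := by
    refine Finset.measurable_prod _ fun i _ => ?_
    have : Measurable fun p : (ℕ → ℝ) × (ℕ → E) => (p.1 i, p.2 i) := by fun_prop
    exact hG.comp this
  have hH : Measurable fun t => ∫⁻ z, G t z ∂ν := hG.lintegral_prod_right
  have hm2 : Measurable fun t : ℕ → ℝ => ∏ i ∈ Finset.range N, ∫⁻ z, G (t i) z ∂ν :=
    Finset.measurable_prod _ fun i _ => hH.comp (measurable_pi_apply i)
  rw [← lintegral_map hm (hζ'.prodMk hZ'), hmap, lintegral_prod _ hm.aemeasurable,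
    ← lintegral_map hm2 hζ']
  refine lintegral_congr fun t => ?_
  have hGt (i) : Measurable (G (t i)) := hG.comp measurable_prodMk_left
  rw [lintegral_map (f := fun z : ℕ → E => ∏ i ∈ Finset.range N, G (t i) (z i))
    (hm.comp measurable_prodMk_left) hZ']
  refine (lintegral_prod_eq_prod_lintegral_of_indepFun _ (fun i ω => G (t i) (Z i ω))
    (hZ.indep.comp _ hGt) fun i => (hGt i).comp (hZ.measurable i)).trans ?_
  refine Finset.prod_congr rfl fun i _ => ?_
  rw [← hZ.map_eq i, lintegral_map (hGt i) (hZ.measurable i)]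

lemma measurable_ofReal_mul {k : E → ℝ≥0∞} (hk : Measurable k) :
    Measurable fun p : ℝ × E => ENNReal.ofReal p.1 * k p.2 :=
  (ENNReal.measurable_ofReal.comp measurable_fst).mul (hk.comp measurable_snd)

/-- Exchange the order of integration: for fixed `z` the set of admissible `t` has mass `k z`. -/
lemma lintegral_frechetIntensity {ν : Measure E} [SFinite ν] {k : E → ℝ≥0∞} (hk : Measurable k) :
    ∫⁻ t, ν {z | 1 < ENNReal.ofReal t * k z} ∂frechetIntensity = ∫⁻ z, k z ∂ν := by
  have hS : MeasurableSet {p : ℝ × E | 1 < ENNReal.ofReal p.1 * k p.2} :=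
    measurableSet_lt measurable_const (measurable_ofReal_mul hk)
  have h1 := Measure.prod_apply (μ := frechetIntensity) (ν := ν) hS
  rw [Measure.prod_apply_symm hS] at h1
  refine h1.symm.trans (lintegral_congr fun z => ?_)
  exact frechetIntensity_one_lt_mul (k z)

/-- The avoidance function of an independently marked Poisson process, where the marks are
completed by further independent marks with law `κ`. -/
lemma measure_forall_le_one (hZ : IsIndepMarking P ζ Z ν)
    (hζ : IsPoissonPointProcess P ζ frechetIntensity) (κ : Measure F) [IsProbabilityMeasure κ]
    {k : E × F → ℝ≥0∞} (hk : Measurable k) :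
    (P.prod (Measure.infinitePi fun _ : ℕ => κ))
      {p | ∀ i, ENNReal.ofReal (ζ i p.1) * k (Z i p.1, p.2 i) ≤ 1} =
      expNeg (∫⁻ z, k z ∂ν.prod κ) := by
  have := hZ.isProbabilityMeasure
  set C := Measure.infinitePi fun _ : ℕ => κ
  let A (t : ℝ) : Set (E × F) := {z | ENNReal.ofReal t * k z ≤ 1}
  have hAm : MeasurableSet {q : ℝ × (E × F) | q.2 ∈ A q.1} :=
    measurableSet_le (measurable_ofReal_mul hk) measurable_const
  have hA (t) : MeasurableSet (A t) := measurable_prodMk_left hAm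
  -- Constraining only the first `N` points gives finite products; the full event is the decreasing
  -- limit.
  let S (N : ℕ) : Set (Ω × (ℕ → F)) := {p | ∀ i < N, (Z i p.1, p.2 i) ∈ A (ζ i p.1)}
  have hS (N) : MeasurableSet (S N) := by
    have : S N = ⋂ i, ⋂ (_ : i < N), {p | (Z i p.1, p.2 i) ∈ A (ζ i p.1)} := by
      ext; simp [S]
    rw [this]
    refine MeasurableSet.iInter fun i => MeasurableSet.iInter fun _ => ?_
    have : Measurable fun p : Ω × (ℕ → F) => (ζ i p.1, (Z i p.1, p.2 i)) :=
      ((hζ.measurable i).comp measurable_fst).prodMk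
        (((hZ.measurable i).comp measurable_fst).prodMk
          ((measurable_pi_apply i).comp measurable_snd))
    exact this hAm
  let G (t : ℝ) (z : E) : ℝ≥0∞ := κ {e | (z, e) ∈ A t}
  have hG : Measurable (Function.uncurry G) := by
    have : MeasurableSet {q : (ℝ × E) × F | (q.1.2, q.2) ∈ A q.1.1} :=
      (MeasurableEquiv.prodAssoc (α := ℝ) (β := E) (γ := F)).measurable hAm
    exact measurable_measure_prodMk_left this
  let H (t : ℝ) : ℝ≥0∞ := (ν.prod κ) (A t)
  have hH : Measurable H := measurable_measure_prodMk_left hAm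
  have hSN (N) : (P.prod C) (S N) = ∫⁻ ω, ∏ i ∈ Finset.range N, H (ζ i ω) ∂P := by
    rw [Measure.prod_apply (hS N)]
    calc _ = ∫⁻ ω, ∏ i ∈ Finset.range N, G (ζ i ω) (Z i ω) ∂P := by
          refine lintegral_congr fun ω => ?_
          have : Prod.mk ω ⁻¹' S N =
              Set.pi (Finset.range N) fun i => {e | (Z i ω, e) ∈ A (ζ i ω)} := by
            ext e; simp [S]
          rw [this]
          exact Measure.infinitePi_pi _ fun i _ => measurable_prodMk_left (hA _)
      _ = _ := by
          rw [hZ.lintegral_prod_range hζ.measurable hG]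
          refine lintegral_congr fun ω => Finset.prod_congr rfl fun i _ => ?_
          exact (Measure.prod_apply (hA _)).symm
  have h1 : Tendsto (fun N => (P.prod C) (S N)) atTop (𝓝 ((P.prod C) (⋂ N, S N))) :=
    tendsto_measure_iInter_atTop (fun N => (hS N).nullMeasurableSet)
      (fun N M h p hp i hi => hp i (hi.trans_le h)) ⟨0, measure_ne_top _ _⟩
  -- Taking logarithms turns the infinite product into a Laplace functional; a vanishing factor
  -- contributes `negLog 0 = ∞`.
  have hHexp (t) : expNeg (negLog (H t)) = H t := expNeg_negLog prob_le_one
  have h2 : Tendsto (fun N => ∫⁻ ω, ∏ i ∈ Finset.range N, H (ζ i ω) ∂P) atTop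
      (𝓝 (∫⁻ ω, expNeg (∑' i, negLog (H (ζ i ω))) ∂P)) := by
    refine tendsto_lintegral_of_dominated_convergence (fun _ => 1) (fun N => ?_)
      (fun N => ae_of_all _ fun ω => Finset.prod_le_one' fun i _ => prob_le_one) (by simp)
      (ae_of_all _ fun ω => ?_)
    · exact Finset.measurable_prod _ fun i _ => hH.comp (hζ.measurable i)
    · have := (continuous_expNeg.tendsto _).comp
        (ENNReal.tendsto_nat_tsum fun i => negLog (H (ζ i ω)))
      refine this.congr fun N => ?_
      simp [expNeg_sum, hHexp]
  simp_rw [hSN] at h1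
  have h3 := tendsto_nhds_unique h1 h2
  rw [hζ.laplace (f := fun t => negLog (H t)) (measurable_negLog.comp hH)] at h3
  simp_rw [hHexp] at h3
  have hset : {p : Ω × (ℕ → F) | ∀ i, ENNReal.ofReal (ζ i p.1) * k (Z i p.1, p.2 i) ≤ 1} =
      ⋂ N, S N := by
    ext p
    simp only [mem_ofPred_eq, mem_iInter, S, A]
    exact ⟨fun h N i _ => h i, fun h i => h (i + 1) i (Nat.lt_succ_self i)⟩
  rw [hset, h3, ← lintegral_frechetIntensity hk]
  congr 1
  -- The Laplace exponent `1 - H t` is the probability that the mark of a point at `t` violates the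
  -- bound.
  refine lintegral_congr fun t => ?_
  rw [← prob_compl_eq_one_sub (hA t)]
  congr 1
  ext z
  simp [A]

/-- Borel–Cantelli: by Campbell's formula the expected number of exceedances is the integral of `k`.
-/
lemma ae_finite_one_lt (hZ : IsIndepMarking P ζ Z ν)
    (hζ : IsPoissonPointProcess P ζ frechetIntensity) {k : E → ℝ≥0∞} (hk : Measurable k)
    (hfin : ∫⁻ z, k z ∂ν ≠ ∞) :
    ∀ᵐ ω ∂P, ∀ᶠ i in atTop, ENNReal.ofReal (ζ i ω) * k (Z i ω) ≤ 1 := by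
  have := hZ.isProbabilityMeasure
  have hS : MeasurableSet {p : ℝ × E | 1 < ENNReal.ofReal p.1 * k p.2} :=
    measurableSet_lt measurable_const (measurable_ofReal_mul hk)
  have hsum : ∑' i, P {ω | 1 < ENNReal.ofReal (ζ i ω) * k (Z i ω)} = ∫⁻ z, k z ∂ν := by
    rw [← lintegral_frechetIntensity hk,
      ← hζ.lintegral_tsum (f := fun t => ν {z | 1 < ENNReal.ofReal t * k z})
        (measurable_measure_prodMk_left hS)]
    refine tsum_congr fun i => ?_
    have hind : IndepFun (ζ i) (Z i) P :=
      hZ.indep_points.comp (measurable_pi_apply i) (measurable_pi_apply i)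
    have hmap := (indepFun_iff_map_prod_eq_prod_map_map (hζ.measurable i).aemeasurable
      (hZ.measurable i).aemeasurable).1 hind
    have := Measure.map_apply (μ := P) ((hζ.measurable i).prodMk (hZ.measurable i)) hS
    rw [hmap, hZ.map_eq, Measure.prod_apply hS,
      lintegral_map (measurable_measure_prodMk_left hS) (hζ.measurable i)] at this
    exact this.symm
  filter_upwards [ae_eventually_notMem (hsum.trans_ne hfin)] with ω hω
  simpa using hω

end IsIndepMarking

/-! ### Fair coins -/

/-- The law of a fair coin. -/
noncomputable def fairCoin : Measure Bool :=
  (2⁻¹ : ℝ≥0∞) • Measure.dirac true + (2⁻¹ : ℝ≥0∞) • Measure.dirac false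

instance : IsProbabilityMeasure fairCoin :=
  ⟨by simp [fairCoin, ENNReal.inv_two_add_inv_two]⟩

lemma lintegral_fairCoin (f : Bool → ℝ≥0∞) :
    ∫⁻ b, f b ∂fairCoin = 2⁻¹ * f true + 2⁻¹ * f false := by
  simp [fairCoin]

/-- The law of a sequence of independent fair coins. -/
noncomputable def fairCoins : Measure (ℕ → Bool) := Measure.infinitePi fun _ => fairCoin

instance : IsProbabilityMeasure fairCoins := by
  unfold fairCoins
  infer_instance

/-- The sign `±1` shown by a coin. -/
def coinSign (b : Bool) : ℝ := if b then 1 else -1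

lemma integral_coinSign : ∫ b, coinSign b ∂fairCoin = 0 := by
  rw [fairCoin, integral_add_measure (by simp [integrable_smul_measure])
      (by simp [integrable_smul_measure]),
    integral_smul_measure, integral_smul_measure, integral_dirac, integral_dirac]
  simp [coinSign]

lemma integral_coinSign_mul (l m : ℕ) :
    ∫ ε, coinSign (ε l) * coinSign (ε m) ∂fairCoins = if l = m then 1 else 0 := by
  have hmeas : Measurable coinSign := measurable_of_countable _
  split_ifs with h
  · subst h
    have : ∀ b, coinSign b * coinSign b = 1 := by simp [coinSign]
    simp [this]
  · have hind : iIndepFun (fun (i : ℕ) (ε : ℕ → Bool) => coinSign (ε i)) fairCoins :=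
      iIndepFun_infinitePi (P := fun _ : ℕ => fairCoin) (X := fun _ => coinSign)
        (fun _ => hmeas)
    have hmi (i : ℕ) : Measurable fun ε : ℕ → Bool => coinSign (ε i) :=
      hmeas.comp (measurable_pi_apply i)
    have := (hind.indepFun h).integral_fun_mul_eq_mul_integral (hmi l).aestronglyMeasurable
      (hmi m).aestronglyMeasurable
    rw [this]
    have h0 : ∫ ε, coinSign (ε l) ∂fairCoins = 0 := by
      have hl := measurePreserving_eval_infinitePi (fun _ : ℕ => fairCoin) l
      rw [← integral_coinSign, ← hl.map_eq,
        integral_map hl.measurable.aemeasurable hmeas.aestronglyMeasurable]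
      rfl
    rw [h0, zero_mul]

/-- Coins agreeing almost surely would have signs whose product has mean 1, against orthogonality.
-/
lemma fairCoins_ne_pos {l m : ℕ} (h : l ≠ m) : fairCoins {ε | ε l ≠ ε m} ≠ 0 := by
  intro h0
  have h1 : ∫ ε, coinSign (ε l) * coinSign (ε m) ∂fairCoins = 1 := by
    have : ∀ᵐ ε ∂fairCoins, coinSign (ε l) * coinSign (ε m) = 1 := by
      filter_upwards [measure_eq_zero_iff_ae_notMem.1 h0] with ε hε
      have : ε l = ε m := by simpa using hε
      rw [this]
      cases ε m <;> simp [coinSign]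
    rw [integral_congr_ae this]
    simp
  rw [integral_coinSign_mul, if_neg h] at h1
  exact zero_ne_one h1

/-! ### Splitting a maximum by coins -/

lemma exists_eq_iSup_of_tendsto_zero {a : ℕ → ℝ} (ha : Tendsto a atTop (𝓝 0))
    (hpos : 0 < ⨆ i, a i) : ∃ l, ⨆ i, a i = a l := by
  by_contra! h
  have hb : BddAbove (range a) := ha.bddAbove_range
  have hlt (i) : a i < ⨆ i, a i := lt_of_le_of_ne (le_ciSup hb i) (h i).symm
  -- Terms from `N` on stay below half the supremum, so finitely many terms decide it; `N + 1` in
  -- the next step keeps that finite set nonempty.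
  obtain ⟨N, hN⟩ := eventually_atTop.1 (ha.eventually (gt_mem_nhds (half_pos hpos)))
  obtain ⟨m, -, hm⟩ := Finset.exists_max_image (Finset.range (N + 1)) a ⟨0, by simp⟩
  have : ⨆ i, a i ≤ max (a m) ((⨆ i, a i) / 2) := by
    refine ciSup_le fun i => ?_
    rcases le_or_gt N i with hi | hi
    · exact le_max_of_le_right (hN i hi).le
    · exact le_max_of_le_left (hm i (by simp; omega))
  exact absurd this (not_le.2 (max_lt (hlt m) (half_lt_self hpos)))

/-- The supremum of the terms `a i` for which the coin `ε i` shows `b`. -/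
noncomputable def coinSup (a : ℕ → ℝ) (ε : ℕ → Bool) (b : Bool) : ℝ :=
  ⨆ i, if ε i = b then a i else 0

lemma coinSup_nonneg {a : ℕ → ℝ} (ha : ∀ i, 0 ≤ a i) (ε : ℕ → Bool) (b : Bool) :
    0 ≤ coinSup a ε b :=
  Real.iSup_nonneg fun i => by split_ifs <;> simp [ha]

/-- The filler value 0 imposes no condition since `0 ≤ x`; boundedness excludes the default value of
a real supremum. -/
lemma coinSup_le_iff {a : ℕ → ℝ} (ha : ∀ i, 0 ≤ a i) (hb : BddAbove (range a)) {ε : ℕ → Bool}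
    {b : Bool} {x : ℝ} (hx : 0 ≤ x) : coinSup a ε b ≤ x ↔ ∀ i, ε i = b → a i ≤ x := by
  obtain ⟨B, hB⟩ := hb
  have hbdd : BddAbove (range fun i => if ε i = b then a i else 0) := by
    refine ⟨B, ?_⟩
    rintro _ ⟨i, rfl⟩
    have hi := hB ⟨i, rfl⟩
    dsimp only
    split_ifs
    · exact hi
    · exact (ha i).trans hi
  rw [coinSup, ciSup_le_iff hbdd]
  refine forall_congr' fun i => ?_
  split_ifs with h <;> simp [h, hx]

/-- The side containing the maximizer `l` reaches the overall supremum, which the other side cannot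
exceed; ties are excluded by `hε`. -/
lemma sign_coinSup_sub {a : ℕ → ℝ} (ha : ∀ i, 0 ≤ a i) (hb : BddAbove (range a))
    {ε : ℕ → Bool} (hε : coinSup a ε true ≠ coinSup a ε false) {l : ℕ} (hl : ⨆ i, a i = a l) :
    Real.sign (coinSup a ε true - coinSup a ε false) = coinSign (ε l) := by
  have hle (b) : coinSup a ε b ≤ a l :=
    (coinSup_le_iff ha hb (ha l)).2 fun i _ => hl ▸ le_ciSup hb i
  have hge : a l ≤ coinSup a ε (ε l) :=
    (coinSup_le_iff ha hb (coinSup_nonneg ha ε _)).1 le_rfl l rfl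
  cases h : ε l
  · rw [h] at hge
    rw [Real.sign_of_neg (sub_neg.2 (lt_of_le_of_ne ((hle _).trans hge) hε))]
    simp [coinSign]
  · rw [h] at hge
    rw [Real.sign_of_pos (sub_pos.2 (lt_of_le_of_ne ((hle _).trans hge) hε.symm))]
    simp [coinSign]

/-- The coins of two maximizers would both equal the same sign almost surely, yet distinct coins
differ with positive probability. Thus uniqueness of the maximizer follows from the absence of ties.
-/
lemma eq_of_eq_iSup {a : ℕ → ℝ} (ha : ∀ i, 0 ≤ a i) (hb : BddAbove (range a))
    (hε : ∀ᵐ ε ∂fairCoins, coinSup a ε true ≠ coinSup a ε false) {l m : ℕ}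
    (hl : ⨆ i, a i = a l) (hm : ⨆ i, a i = a m) : l = m := by
  by_contra h
  refine fairCoins_ne_pos h (measure_eq_zero_iff_ae_notMem.2 ?_)
  filter_upwards [hε] with ε hε'
  have := (sign_coinSup_sub ha hb hε' hl).symm.trans (sign_coinSup_sub ha hb hε' hm)
  revert this
  cases ε l <;> cases ε m <;> norm_num [coinSign]

-- The two signs are the coins of the maximizers `l` and `m`. Orthogonality leaves the indicator of
-- `l = m`, which is concurrence because maximizers are unique.
open Classical in
lemma integral_sign_coinSup {a a' : ℕ → ℝ} (ha : ∀ i, 0 ≤ a i) (ha' : ∀ i, 0 ≤ a' i)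
    (hlim : Tendsto a atTop (𝓝 0)) (hlim' : Tendsto a' atTop (𝓝 0))
    (hpos : 0 < ⨆ i, a i) (hpos' : 0 < ⨆ i, a' i)
    (hε : ∀ᵐ ε ∂fairCoins, coinSup a ε true ≠ coinSup a ε false)
    (hε' : ∀ᵐ ε ∂fairCoins, coinSup a' ε true ≠ coinSup a' ε false) :
    ∫ ε, Real.sign (coinSup a ε true - coinSup a ε false) *
        Real.sign (coinSup a' ε true - coinSup a' ε false) ∂fairCoins =
      if ∃ l, ⨆ i, a i = a l ∧ ⨆ i, a' i = a' l then 1 else 0 := by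
  have hb := hlim.bddAbove_range
  have hb' := hlim'.bddAbove_range
  obtain ⟨l, hl⟩ := exists_eq_iSup_of_tendsto_zero hlim hpos
  obtain ⟨m, hm⟩ := exists_eq_iSup_of_tendsto_zero hlim' hpos'
  have h1 : ∫ ε, Real.sign (coinSup a ε true - coinSup a ε false) *
        Real.sign (coinSup a' ε true - coinSup a' ε false) ∂fairCoins =
      ∫ ε, coinSign (ε l) * coinSign (ε m) ∂fairCoins := by
    refine integral_congr_ae ?_
    filter_upwards [hε, hε'] with ε h h'
    rw [sign_coinSup_sub ha hb h hl, sign_coinSup_sub ha' hb' h' hm]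
  rw [h1, integral_coinSign_mul]
  refine if_congr ⟨fun h => ⟨l, hl, h ▸ hm⟩, ?_⟩ rfl rfl
  rintro ⟨n, hn, hn'⟩
  rw [eq_of_eq_iSup ha hb hε hl hn, eq_of_eq_iSup ha' hb' hε' hm hn']

/-! ### Joint laws of maxima and max-stability -/

/-- The quantity `max (a / x) (b / y)` for nonnegative numbers. -/
noncomputable def maxRatio (x y : ℝ) (z : ℝ × ℝ) : ℝ≥0∞ :=
  max (ENNReal.ofReal z.1 / ENNReal.ofReal x) (ENNReal.ofReal z.2 / ENNReal.ofReal y)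

lemma measurable_maxRatio (x y : ℝ) : Measurable (maxRatio x y) := by
  unfold maxRatio
  fun_prop

/-- Zero thresholds are covered by the conventions `0 / 0 = 0`, `a / 0 = ∞` for `a > 0`, and `0 * ∞
= 0`. -/
lemma ofReal_mul_maxRatio_le_one {t x y : ℝ} {z : ℝ × ℝ} (ht : 0 ≤ t) (hx : 0 ≤ x) (hy : 0 ≤ y) :
    ENNReal.ofReal t * maxRatio x y z ≤ 1 ↔ t * z.1 ≤ x ∧ t * z.2 ≤ y := by
  have h {a x : ℝ} (hx : 0 ≤ x) :
      ENNReal.ofReal t * (ENNReal.ofReal a / ENNReal.ofReal x) ≤ 1 ↔ t * a ≤ x := by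
    rw [← mul_div_assoc, ← ENNReal.ofReal_mul ht,
      ENNReal.div_le_iff_le_mul (Or.inr ENNReal.one_ne_top) (Or.inr one_ne_zero), one_mul,
      ENNReal.ofReal_le_ofReal_iff hx]
  rw [maxRatio, mul_max, max_le_iff, h hx, h hy]

/-- This homogeneity is the source of max-stability: its factor `2⁻¹` matches the probability of a
coin face. -/
lemma maxRatio_two_mul (x y : ℝ) (z : ℝ × ℝ) :
    maxRatio (2 * x) (2 * y) z = 2⁻¹ * maxRatio x y z := by
  have h (a : ℝ≥0∞) (x : ℝ) : a / ENNReal.ofReal (2 * x) = 2⁻¹ * (a / ENNReal.ofReal x) := by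
    rw [ENNReal.ofReal_mul zero_le_two, ENNReal.ofReal_ofNat, div_eq_mul_inv,
      ENNReal.mul_inv (Or.inl two_ne_zero) (Or.inl ENNReal.ofNat_ne_top), div_eq_mul_inv]
    ring
  rw [maxRatio, maxRatio, h, h, mul_max]

/-- The maximum at `s` of the functions `φ_i` whose coin shows `b`. -/
noncomputable def thinnedMax {T Ω : Type*} (ζ : ℕ → Ω → ℝ) (Y : ℕ → T → Ω → ℝ) (s : T) (b : Bool)
    (p : Ω × (ℕ → Bool)) : ℝ :=
  coinSup (fun i => spectralFun ζ Y i s p.1) p.2 b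

namespace IsSpectralData

variable {T Ω : Type*} [MeasurableSpace Ω] {P : Measure Ω} [IsProbabilityMeasure P]
  {ζ : ℕ → Ω → ℝ} {Y : ℕ → T → Ω → ℝ}

omit [IsProbabilityMeasure P] in
lemma isIndepMarking (h : IsSpectralData P ζ Y) (s₁ s₂ : T) :
    IsIndepMarking P ζ (fun i ω => (Y i s₁ ω, Y i s₂ ω)) (P.map fun ω => (Y 0 s₁ ω, Y 0 s₂ ω)) := by
  have hev : Measurable fun f : T → ℝ => (f s₁, f s₂) := by fun_prop
  refine ⟨fun i => (h.measurable i s₁).prodMk (h.measurable i s₂), ?_, fun i => ?_, ?_⟩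
  · exact h.indep.comp (fun _ f => (f s₁, f s₂)) fun _ => hev
  · exact ((h.identDistrib i).comp hev).map_eq
  · exact h.indep_points.comp (φ := id) (ψ := fun f i => (f i s₁, f i s₂)) measurable_id
      (by fun_prop)

omit [IsProbabilityMeasure P] in
lemma lintegral_ofReal (h : IsSpectralData P ζ Y) (s : T) :
    ∫⁻ ω, ENNReal.ofReal (Y 0 s ω) ∂P = 1 := by
  have hi : Integrable (Y 0 s) P := by
    by_contra hn
    exact zero_ne_one ((integral_undef hn).symm.trans (h.mean_one 0 s))
  rw [← ofReal_integral_eq_lintegral_ofReal hi (ae_of_all _ (h.nonneg 0 s)), h.mean_one,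
    ENNReal.ofReal_one]

omit [IsProbabilityMeasure P] in
lemma spectralFun_nonneg (h : IsSpectralData P ζ Y) (i : ℕ) (s : T) (ω : Ω) :
    0 ≤ spectralFun ζ Y i s ω :=
  mul_nonneg (h.pos i ω).le (h.nonneg i s ω)

omit [IsProbabilityMeasure P] in
lemma measurable_spectralFun (h : IsSpectralData P ζ Y) (i : ℕ) (s : T) :
    Measurable (spectralFun ζ Y i s) :=
  (h.poisson.measurable i).mul (h.measurable i s)

omit [IsProbabilityMeasure P] in
lemma measurable_spectralMax (h : IsSpectralData P ζ Y) (s : T) :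
    Measurable (spectralMax ζ Y s) :=
  Measurable.iSup fun i => h.measurable_spectralFun i s

omit [IsProbabilityMeasure P] in
lemma measurable_thinnedMax (h : IsSpectralData P ζ Y) (s : T) (b : Bool) :
    Measurable (thinnedMax ζ Y s b) := by
  refine Measurable.iSup fun i => Measurable.ite ?_ ?_ measurable_const
  · exact ((measurable_pi_apply (X := fun _ : ℕ => Bool) i).comp measurable_snd)
      (measurableSet_singleton b)
  · exact (h.measurable_spectralFun i s).comp measurable_fst

/-- Since `Y` has mean one, the expected number of `φ_i(s)` above `1 / (n + 1)` is `n + 1`, so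
almost surely only finitely many exceed it. -/
lemma ae_tendsto_zero (h : IsSpectralData P ζ Y) (s : T) :
    ∀ᵐ ω ∂P, Tendsto (fun i => spectralFun ζ Y i s ω) atTop (𝓝 0) := by
  have hn (n : ℕ) : ∀ᵐ ω ∂P, ∀ᶠ i in atTop, spectralFun ζ Y i s ω ≤ 1 / ((n : ℝ) + 1) := by
    have hpos : (0 : ℝ) < 1 / ((n : ℝ) + 1) := by positivity
    have := (h.isIndepMarking s s).ae_finite_one_lt h.poisson
      (measurable_maxRatio (1 / ((n : ℝ) + 1)) (1 / ((n : ℝ) + 1))) (by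
        rw [lintegral_map (measurable_maxRatio _ _) ((h.measurable 0 s).prodMk (h.measurable 0 s))]
        simp only [maxRatio, max_self, div_eq_mul_inv]
        rw [lintegral_mul_const _ (h.measurable 0 s).ennreal_ofReal, h.lintegral_ofReal, one_mul]
        simpa using hpos)
    filter_upwards [this] with ω hω
    filter_upwards [hω] with i hi
    exact ((ofReal_mul_maxRatio_le_one (h.pos i ω).le hpos.le hpos.le).1 hi).1
  filter_upwards [ae_all_iff.2 hn] with ω hω
  refine tendsto_order.2 ⟨fun a ha => Eventually.of_forall fun i =>
    ha.trans_le (h.spectralFun_nonneg i s ω), fun a ha => ?_⟩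
  obtain ⟨n, hn⟩ := exists_nat_one_div_lt ha
  filter_upwards [hω n] with i hi
  exact hi.trans_lt hn

/-- The joint distribution function of the thinned maxima at two sites. -/
lemma measure_thinnedMax_le (h : IsSpectralData P ζ Y) (s₁ s₂ : T) {x y x' y' : ℝ}
    (hx : 0 ≤ x) (hy : 0 ≤ y) (hx' : 0 ≤ x') (hy' : 0 ≤ y') :
    (P.prod fairCoins) {p | (thinnedMax ζ Y s₁ true p ≤ x ∧ thinnedMax ζ Y s₂ true p ≤ y) ∧
      thinnedMax ζ Y s₁ false p ≤ x' ∧ thinnedMax ζ Y s₂ false p ≤ y'} =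
    expNeg (2⁻¹ * ∫⁻ ω, maxRatio x y (Y 0 s₁ ω, Y 0 s₂ ω) ∂P) *
      expNeg (2⁻¹ * ∫⁻ ω, maxRatio x' y' (Y 0 s₁ ω, Y 0 s₂ ω) ∂P) := by
  have hYm : Measurable fun ω => (Y 0 s₁ ω, Y 0 s₂ ω) :=
    (h.measurable 0 s₁).prodMk (h.measurable 0 s₂)
  have hm := measurable_maxRatio x y
  have hm' := measurable_maxRatio x' y'
  -- The coin acts as an extra mark selecting the pair of thresholds; averaging over it splits the
  -- exponent into two halves, hence independence.
  let k (z : (ℝ × ℝ) × Bool) : ℝ≥0∞ := if z.2 = true then maxRatio x y z.1 else maxRatio x' y' z.1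
  have hk : Measurable k := by
    refine Measurable.ite (measurable_snd (measurableSet_singleton true)) ?_ ?_ <;> fun_prop
  have hmain := (h.isIndepMarking s₁ s₂).measure_forall_le_one h.poisson fairCoin hk
  have hint : ∫⁻ z, k z ∂(P.map fun ω => (Y 0 s₁ ω, Y 0 s₂ ω)).prod fairCoin =
      2⁻¹ * ∫⁻ ω, maxRatio x y (Y 0 s₁ ω, Y 0 s₂ ω) ∂P +
      2⁻¹ * ∫⁻ ω, maxRatio x' y' (Y 0 s₁ ω, Y 0 s₂ ω) ∂P := by
    rw [lintegral_prod _ hk.aemeasurable]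
    simp_rw [lintegral_fairCoin]
    simp only [k, if_true, Bool.false_eq_true, if_false]
    rw [lintegral_map (by fun_prop) hYm, lintegral_add_left (by fun_prop),
      lintegral_const_mul _ (by fun_prop), lintegral_const_mul _ (by fun_prop)]
  rw [hint, expNeg_add] at hmain
  rw [← hmain]
  refine measure_congr ?_
  filter_upwards [Measure.quasiMeasurePreserving_fst.ae (h.ae_tendsto_zero s₁),
    Measure.quasiMeasurePreserving_fst.ae (h.ae_tendsto_zero s₂)] with p h1 h2
  refine propext ?_
  have hc {s : T} (hs : Tendsto (fun i => spectralFun ζ Y i s p.1) atTop (𝓝 0)) (b : Bool)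
      {u : ℝ} (hu : 0 ≤ u) : thinnedMax ζ Y s b p ≤ u ↔
        ∀ i, p.2 i = b → ζ i p.1 * Y i s p.1 ≤ u :=
    coinSup_le_iff (fun i => h.spectralFun_nonneg i s p.1) hs.bddAbove_range hu
  change ((thinnedMax ζ Y s₁ true p ≤ x ∧ thinnedMax ζ Y s₂ true p ≤ y) ∧
      thinnedMax ζ Y s₁ false p ≤ x' ∧ thinnedMax ζ Y s₂ false p ≤ y') ↔
    ∀ i, ENNReal.ofReal (ζ i p.1) * k ((Y i s₁ p.1, Y i s₂ p.1), p.2 i) ≤ 1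
  rw [hc h1 _ hx, hc h2 _ hy, hc h1 _ hx', hc h2 _ hy', ← forall_and, ← forall_and, ← forall_and]
  refine forall_congr' fun i => ?_
  cases hb : p.2 i
  · simp [k, ofReal_mul_maxRatio_le_one (h.pos i p.1).le hx' hy']
  · simp [k, ofReal_mul_maxRatio_le_one (h.pos i p.1).le hx hy]

/-- The joint distribution function of the maxima at two sites. -/
lemma measure_spectralMax_le (h : IsSpectralData P ζ Y) (s₁ s₂ : T) {x y : ℝ}
    (hx : 0 ≤ x) (hy : 0 ≤ y) :
    P {ω | spectralMax ζ Y s₁ ω ≤ x ∧ spectralMax ζ Y s₂ ω ≤ y} =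
    expNeg (∫⁻ ω, maxRatio x y (Y 0 s₁ ω, Y 0 s₂ ω) ∂P) := by
  have hYm : Measurable fun ω => (Y 0 s₁ ω, Y 0 s₂ ω) :=
    (h.measurable 0 s₁).prodMk (h.measurable 0 s₂)
  have hm := measurable_maxRatio x y
  -- Here `k` ignores the coin, so the coins integrate out.
  have hmain := (h.isIndepMarking s₁ s₂).measure_forall_le_one h.poisson fairCoin
    (k := fun z => maxRatio x y z.1) (by fun_prop)
  have hset : {p : Ω × (ℕ → Bool) | ∀ i, ENNReal.ofReal (ζ i p.1) *
      maxRatio x y (Y i s₁ p.1, Y i s₂ p.1) ≤ 1} =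
      {ω | ∀ i, ENNReal.ofReal (ζ i ω) * maxRatio x y (Y i s₁ ω, Y i s₂ ω) ≤ 1} ×ˢ univ := by
    ext; simp
  rw [lintegral_prod _ (by fun_prop)] at hmain
  simp only [lintegral_const, measure_univ, mul_one] at hmain
  rw [hset, Measure.prod_prod, measure_univ, mul_one, lintegral_map hm hYm] at hmain
  rw [← hmain]
  refine measure_congr ?_
  filter_upwards [h.ae_tendsto_zero s₁, h.ae_tendsto_zero s₂] with ω h1 h2
  refine propext ?_
  change (spectralMax ζ Y s₁ ω ≤ x ∧ spectralMax ζ Y s₂ ω ≤ y) ↔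
    ∀ i, ENNReal.ofReal (ζ i ω) * maxRatio x y (Y i s₁ ω, Y i s₂ ω) ≤ 1
  rw [spectralMax, spectralMax, ciSup_le_iff h1.bddAbove_range, ciSup_le_iff h2.bddAbove_range,
    ← forall_and]
  refine forall_congr' fun i => ?_
  rw [ofReal_mul_maxRatio_le_one (h.pos i ω).le hx hy]
  rfl

omit [IsProbabilityMeasure P] in
lemma spectralMax_nonneg (h : IsSpectralData P ζ Y) (s : T) (ω : Ω) : 0 ≤ spectralMax ζ Y s ω :=
  Real.iSup_nonneg fun i => h.spectralFun_nonneg i s ω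

omit [IsProbabilityMeasure P] in
lemma thinnedMax_nonneg (h : IsSpectralData P ζ Y) (s : T) (b : Bool) (p : Ω × (ℕ → Bool)) :
    0 ≤ thinnedMax ζ Y s b p :=
  coinSup_nonneg (fun i => h.spectralFun_nonneg i s p.1) _ _

/-- The margins are unit Fréchet. -/
lemma map_spectralMax_Iic (h : IsSpectralData P ζ Y) (s : T) (x : ℝ) :
    P.map (spectralMax ζ Y s) (Iic x) = expNeg (ENNReal.ofReal x)⁻¹ := by
  rw [Measure.map_apply (h.measurable_spectralMax s) measurableSet_Iic]
  rcases lt_or_ge x 0 with hx | hx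
  · have : spectralMax ζ Y s ⁻¹' Iic x = ∅ := by
      ext ω
      simpa using hx.trans_le (h.spectralMax_nonneg s ω)
    simp [this, ENNReal.ofReal_of_nonpos hx.le]
  · have := h.measure_spectralMax_le s s hx hx
    simp only [maxRatio, max_self, div_eq_mul_inv, and_self] at this
    rw [lintegral_mul_const _ (h.measurable 0 s).ennreal_ofReal, h.lintegral_ofReal, one_mul]
      at this
    exact this

lemma ae_spectralMax_pos (h : IsSpectralData P ζ Y) (s : T) :
    ∀ᵐ ω ∂P, 0 < spectralMax ζ Y s ω := by
  have := h.map_spectralMax_Iic s 0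
  rw [Measure.map_apply (h.measurable_spectralMax s) measurableSet_Iic] at this
  simp only [ENNReal.ofReal_zero, ENNReal.inv_zero, expNeg_top] at this
  filter_upwards [measure_eq_zero_iff_ae_notMem.1 this] with ω hω
  simpa using hω

/-- The Fréchet distribution function is continuous, so letting `y` increase to `x` in `hle` leaves
no mass at `x`. -/
lemma nullSingletonClass_map_spectralMax (h : IsSpectralData P ζ Y) (s : T) :
    NullSingletonClass (P.map (spectralMax ζ Y s)) := by
  refine ⟨fun x => ?_⟩
  set μ := P.map (spectralMax ζ Y s)
  have : IsProbabilityMeasure μ :=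
    Measure.isProbabilityMeasure_map (h.measurable_spectralMax s).aemeasurable
  have hle : ∀ y < x, μ {x} + μ (Iic y) ≤ μ (Iic x) := fun y hy => by
    rw [← measure_union (by simpa using hy) measurableSet_Iic]
    exact measure_mono (union_subset (by simp) (Iic_subset_Iic.2 hy.le))
  have hcont : Continuous fun y : ℝ => μ (Iic y) := by
    simp_rw [μ, h.map_spectralMax_Iic s]
    exact continuous_expNeg.comp (continuous_inv.comp ENNReal.continuous_ofReal)
  have hlim : Tendsto (fun y => μ {x} + μ (Iic y)) (𝓝[<] x) (𝓝 (μ {x} + μ (Iic x))) :=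
    ((continuous_const.add hcont).tendsto x).mono_left nhdsWithin_le_nhds
  have hfin := le_of_tendsto hlim (eventually_nhdsWithin_of_forall hle)
  have hle0 : μ {x} + μ (Iic x) ≤ 0 + μ (Iic x) := by rwa [zero_add]
  exact nonpos_iff_eq_zero.1 ((ENNReal.add_le_add_iff_right (measure_ne_top μ _)).1 hle0)

/-- Max-stability: up to the factor `2`, the thinned maxima are independent copies of the
process. -/
lemma map_thinnedMax (h : IsSpectralData P ζ Y) (s₁ s₂ : T) :
    (P.prod fairCoins).map (fun p => ((thinnedMax ζ Y s₁ true p, thinnedMax ζ Y s₂ true p),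
      (thinnedMax ζ Y s₁ false p, thinnedMax ζ Y s₂ false p))) =
    (P.map fun ω => (spectralMax ζ Y s₁ ω / 2, spectralMax ζ Y s₂ ω / 2)).prod
      (P.map fun ω => (spectralMax ζ Y s₁ ω / 2, spectralMax ζ Y s₂ ω / 2)) := by
  have hM : Measurable fun ω => (spectralMax ζ Y s₁ ω / 2, spectralMax ζ Y s₂ ω / 2) :=
    ((h.measurable_spectralMax s₁).div_const 2).prodMk ((h.measurable_spectralMax s₂).div_const 2)
  set μ := P.map fun ω => (spectralMax ζ Y s₁ ω / 2, spectralMax ζ Y s₂ ω / 2) with hμ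
  have : IsProbabilityMeasure μ := Measure.isProbabilityMeasure_map hM.aemeasurable
  have hT : Measurable fun p => ((thinnedMax ζ Y s₁ true p, thinnedMax ζ Y s₂ true p),
      (thinnedMax ζ Y s₁ false p, thinnedMax ζ Y s₂ false p)) :=
    ((h.measurable_thinnedMax s₁ _).prodMk (h.measurable_thinnedMax s₂ _)).prodMk
      ((h.measurable_thinnedMax s₁ _).prodMk (h.measurable_thinnedMax s₂ _))
  let R : Set (Set (ℝ × ℝ)) := image2 (· ×ˢ ·) (range Iic) (range Iic)
  have hcs : IsCountablySpanning (range (Iic : ℝ → Set ℝ)) := by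
    refine ⟨fun n => Iic (n : ℝ), fun n => mem_range_self _, ?_⟩
    refine eq_univ_of_forall fun x => mem_iUnion.2 ?_
    exact exists_nat_ge x
  have hgen1 : MeasurableSpace.generateFrom (range (Iic : ℝ → Set ℝ)) = Real.measurableSpace :=
    (borel_eq_generateFrom_Iic ℝ).symm.trans (BorelSpace.measurable_eq (α := ℝ)).symm
  have hgen : MeasurableSpace.generateFrom R = Prod.instMeasurableSpace :=
    generateFrom_eq_prod hgen1 hgen1 hcs hcs
  have hpi : IsPiSystem R := isPiSystem_Iic.prod isPiSystem_Iic
  have hspan : μ.FiniteSpanningSetsIn R := by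
    refine ⟨fun n => Iic (n : ℝ) ×ˢ Iic (n : ℝ), fun n => ⟨_, mem_range_self _, _,
      mem_range_self _, rfl⟩, fun n => measure_lt_top _ _, ?_⟩
    refine eq_univ_of_forall fun x => mem_iUnion.2 ?_
    obtain ⟨n, hn⟩ := exists_nat_ge (max x.1 x.2)
    exact ⟨n, (le_max_left _ _).trans hn, (le_max_right _ _).trans hn⟩
  have hneg {x y : ℝ} (hxy : ¬ (0 ≤ x ∧ 0 ≤ y)) : μ (Iic x ×ˢ Iic y) = 0 := by
    rw [hμ, Measure.map_apply hM (measurableSet_Iic.prod measurableSet_Iic)]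
    convert measure_empty (μ := P)
    ext ω
    simp only [mem_preimage, mem_prod, mem_Iic, mem_empty_iff_false, iff_false]
    intro hω
    have h1 := h.spectralMax_nonneg s₁ ω
    have h2 := h.spectralMax_nonneg s₂ ω
    exact hxy ⟨by linarith, by linarith⟩
  have hpos {x y : ℝ} (hx : 0 ≤ x) (hy : 0 ≤ y) : μ (Iic x ×ˢ Iic y) =
      expNeg (2⁻¹ * ∫⁻ ω, maxRatio x y (Y 0 s₁ ω, Y 0 s₂ ω) ∂P) := by
    rw [hμ, Measure.map_apply hM (measurableSet_Iic.prod measurableSet_Iic),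
      ← lintegral_const_mul (f := fun ω => maxRatio x y (Y 0 s₁ ω, Y 0 s₂ ω)) _
        ((measurable_maxRatio x y).comp ((h.measurable 0 s₁).prodMk (h.measurable 0 s₂)))]
    simp_rw [← maxRatio_two_mul]
    rw [← h.measure_spectralMax_le s₁ s₂ (by positivity) (by positivity)]
    congr 1
    ext ω
    simp [div_le_iff₀', mul_comm]
  -- Products of lower quadrants determine the law; if some threshold is negative, both sides vanish
  -- by nonnegativity of the maxima.
  refine (Measure.prod_eq_generateFrom hgen hgen hpi hpi hspan hspan ?_).symm
  rintro _ ⟨_, ⟨x, rfl⟩, _, ⟨y, rfl⟩, rfl⟩ _ ⟨_, ⟨x', rfl⟩, _, ⟨y', rfl⟩, rfl⟩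
  dsimp only
  have hms (a b : ℝ) : MeasurableSet (Iic a ×ˢ Iic b : Set (ℝ × ℝ)) :=
    measurableSet_Iic.prod measurableSet_Iic
  rw [Measure.map_apply hT ((hms x y).prod (hms x' y'))]
  by_cases hall : (0 ≤ x ∧ 0 ≤ y) ∧ 0 ≤ x' ∧ 0 ≤ y'
  · obtain ⟨⟨hx, hy⟩, hx', hy'⟩ := hall
    rw [hpos hx hy, hpos hx' hy', ← h.measure_thinnedMax_le s₁ s₂ hx hy hx' hy']
    rfl
  · have h0 : μ (Iic x ×ˢ Iic y) * μ (Iic x' ×ˢ Iic y') = 0 := by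
      rw [not_and_or] at hall
      rcases hall with hc | hc
      · rw [hneg hc, zero_mul]
      · rw [hneg hc, mul_zero]
    rw [h0]
    convert measure_empty (μ := P.prod fairCoins)
    ext p
    simp only [mem_preimage, mem_prod, mem_Iic, mem_empty_iff_false, iff_false]
    rintro ⟨⟨h1, h2⟩, h3, h4⟩
    exact hall ⟨⟨(h.thinnedMax_nonneg _ _ p).trans h1, (h.thinnedMax_nonneg _ _ p).trans h2⟩,
      (h.thinnedMax_nonneg _ _ p).trans h3, (h.thinnedMax_nonneg _ _ p).trans h4⟩

/-- The thinned maxima are jointly distributed as independent variables with atomless law, for which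
the diagonal is null. -/
lemma ae_thinnedMax_ne (h : IsSpectralData P ζ Y) (s : T) :
    ∀ᵐ p ∂P.prod fairCoins, thinnedMax ζ Y s true p ≠ thinnedMax ζ Y s false p := by
  have hM : Measurable fun ω => (spectralMax ζ Y s ω / 2, spectralMax ζ Y s ω / 2) :=
    ((h.measurable_spectralMax s).div_const 2).prodMk ((h.measurable_spectralMax s).div_const 2)
  have hT : Measurable fun p => ((thinnedMax ζ Y s true p, thinnedMax ζ Y s true p),
      (thinnedMax ζ Y s false p, thinnedMax ζ Y s false p)) :=
    ((h.measurable_thinnedMax s _).prodMk (h.measurable_thinnedMax s _)).prodMk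
      ((h.measurable_thinnedMax s _).prodMk (h.measurable_thinnedMax s _))
  have hD : MeasurableSet {q : (ℝ × ℝ) × (ℝ × ℝ) | q.1.1 = q.2.1} :=
    measurableSet_eq_fun (by fun_prop) (by fun_prop)
  have hmap := congrArg (fun μ => μ {q : (ℝ × ℝ) × (ℝ × ℝ) | q.1.1 = q.2.1})
    (h.map_thinnedMax s s)
  have : IsProbabilityMeasure (P.map fun ω => (spectralMax ζ Y s ω / 2, spectralMax ζ Y s ω / 2)) :=
    Measure.isProbabilityMeasure_map hM.aemeasurable
  have hzero : ∀ q : ℝ × ℝ, (P.map fun ω => (spectralMax ζ Y s ω / 2, spectralMax ζ Y s ω / 2))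
      (Prod.mk q ⁻¹' {q : (ℝ × ℝ) × (ℝ × ℝ) | q.1.1 = q.2.1}) = 0 := fun q => by
    have := h.nullSingletonClass_map_spectralMax s
    have h0 := measure_singleton (μ := P.map (spectralMax ζ Y s)) (2 * q.1)
    rw [Measure.map_apply (h.measurable_spectralMax s) (measurableSet_singleton _)] at h0
    rw [Measure.map_apply hM (measurable_prodMk_left hD)]
    refine measure_mono_null (fun ω hω => ?_) h0
    have hω : q.1 = spectralMax ζ Y s ω / 2 := hω
    change spectralMax ζ Y s ω = 2 * q.1
    rw [hω]
    ring
  rw [Measure.map_apply hT hD, Measure.prod_apply hD, lintegral_congr hzero, lintegral_zero]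
    at hmap
  exact measure_eq_zero_iff_ae_notMem.1 hmap

end IsSpectralData

/-! ### Kendall's tau: dependence on the law and invariance -/

lemma measurable_sign : Measurable Real.sign :=
  Measurable.ite measurableSet_Iio measurable_const
    (Measurable.ite measurableSet_Ioi measurable_const measurable_const)

/-- The integrand of Kendall's tau. -/
noncomputable def signProd (q : (ℝ × ℝ) × (ℝ × ℝ)) : ℝ :=
  Real.sign (q.1.1 - q.2.1) * Real.sign (q.1.2 - q.2.2)

lemma measurable_signProd : Measurable signProd :=
  (measurable_sign.comp (by fun_prop)).mul (measurable_sign.comp (by fun_prop))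

lemma abs_sign_le_one (x : ℝ) : |Real.sign x| ≤ 1 := by
  rcases Real.sign_apply_eq x with h | h | h <;> simp [h]

lemma norm_signProd_le (q : (ℝ × ℝ) × (ℝ × ℝ)) : ‖signProd q‖ ≤ 1 := by
  rw [signProd, Real.norm_eq_abs, abs_mul]
  exact mul_le_one₀ (abs_sign_le_one _) (abs_nonneg _) (abs_sign_le_one _)

lemma StrictMonoOn.sign_sub {h : ℝ → ℝ} {S : Set ℝ} (hh : StrictMonoOn h S) {x y : ℝ}
    (hx : x ∈ S) (hy : y ∈ S) : Real.sign (h x - h y) = Real.sign (x - y) := by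
  rcases lt_trichotomy x y with hxy | rfl | hxy
  · rw [Real.sign_of_neg (sub_neg.2 hxy), Real.sign_of_neg (sub_neg.2 (hh hx hy hxy))]
  · simp
  · rw [Real.sign_of_pos (sub_pos.2 hxy), Real.sign_of_pos (sub_pos.2 (hh hy hx hxy))]

section KendallTau

variable {Ω Ω' : Type*} [MeasurableSpace Ω] [MeasurableSpace Ω']
  {P : Measure Ω} [IsProbabilityMeasure P] {P' : Measure Ω'} [IsProbabilityMeasure P']

lemma kendallTau_eq_integral_map {U V : Ω → ℝ} (h : AEMeasurable (fun ω => (U ω, V ω)) P) :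
    kendallTau P U V =
      ∫ q, signProd q ∂(P.map fun ω => (U ω, V ω)).prod (P.map fun ω => (U ω, V ω)) := by
  have hf := h.measurable_mk
  rw [Measure.map_congr h.ae_eq_mk, Measure.map_prod_map _ _ hf hf,
    integral_map (by fun_prop) measurable_signProd.aestronglyMeasurable]
  refine integral_congr_ae ?_
  filter_upwards [Measure.quasiMeasurePreserving_fst.ae h.ae_eq_mk,
    Measure.quasiMeasurePreserving_snd.ae h.ae_eq_mk] with z h1 h2
  simp only [Prod.map, ← h1, ← h2]
  rfl

lemma ProbabilityTheory.IdentDistrib.kendallTau_eq {U V : Ω → ℝ} {U' V' : Ω' → ℝ}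
    (h : IdentDistrib (fun ω => (U ω, V ω)) (fun ω => (U' ω, V' ω)) P P') :
    kendallTau P U V = kendallTau P' U' V' := by
  rw [kendallTau_eq_integral_map h.aemeasurable_fst, kendallTau_eq_integral_map h.aemeasurable_snd,
    h.map_eq]

omit [IsProbabilityMeasure P] in
-- Monotonicity on sets carrying the variables suffices, as the margin transformations are
-- controlled only on `(0, ∞)`.
lemma kendallTau_strictMonoOn {U V : Ω → ℝ} {h g : ℝ → ℝ} {S S' : Set ℝ}
    (hh : StrictMonoOn h S) (hg : StrictMonoOn g S') (hU : ∀ᵐ ω ∂P, U ω ∈ S)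
    (hV : ∀ᵐ ω ∂P, V ω ∈ S') :
    kendallTau P (fun ω => h (U ω)) (fun ω => g (V ω)) = kendallTau P U V := by
  refine integral_congr_ae ?_
  filter_upwards [Measure.quasiMeasurePreserving_fst.ae hU,
    Measure.quasiMeasurePreserving_snd.ae hU, Measure.quasiMeasurePreserving_fst.ae hV,
    Measure.quasiMeasurePreserving_snd.ae hV] with z h1 h2 h3 h4
  rw [hh.sign_sub h1 h2, hg.sign_sub h3 h4]

end KendallTau

/-! ### Concurrence probability and Kendall's tau -/

/-- The concurrence probability of the maxima of a spectral representation is their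
Kendall's tau. -/
lemma IsSpectralData.extremalConcurrenceProb_eq {T Ω : Type*} [MeasurableSpace Ω] {P : Measure Ω}
    [IsProbabilityMeasure P] {ζ : ℕ → Ω → ℝ} {Y : ℕ → T → Ω → ℝ} (h : IsSpectralData P ζ Y)
    (s₁ s₂ : T) :
    extremalConcurrenceProb P ζ Y ![s₁, s₂] =
      kendallTau P (spectralMax ζ Y s₁) (spectralMax ζ Y s₂) := by
  classical
  have hM : Measurable fun ω => (spectralMax ζ Y s₁ ω / 2, spectralMax ζ Y s₂ ω / 2) :=
    ((h.measurable_spectralMax s₁).div_const 2).prodMk ((h.measurable_spectralMax s₂).div_const 2)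
  have hT : Measurable fun p => ((thinnedMax ζ Y s₁ true p, thinnedMax ζ Y s₂ true p),
      (thinnedMax ζ Y s₁ false p, thinnedMax ζ Y s₂ false p)) :=
    ((h.measurable_thinnedMax s₁ _).prodMk (h.measurable_thinnedMax s₂ _)).prodMk
      ((h.measurable_thinnedMax s₁ _).prodMk (h.measurable_thinnedMax s₂ _))
  have hhalf : kendallTau P (spectralMax ζ Y s₁) (spectralMax ζ Y s₂) =
      kendallTau P (fun ω => spectralMax ζ Y s₁ ω / 2) (fun ω => spectralMax ζ Y s₂ ω / 2) := by
    have hmono : StrictMonoOn (fun x : ℝ => x / 2) univ := fun x _ y _ hxy => by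
      dsimp only
      linarith
    exact (kendallTau_strictMonoOn hmono hmono (by simp) (by simp)).symm
  have hint : Integrable (fun p => signProd
      ((thinnedMax ζ Y s₁ true p, thinnedMax ζ Y s₂ true p),
      (thinnedMax ζ Y s₁ false p, thinnedMax ζ Y s₂ false p))) (P.prod fairCoins) :=
    Integrable.of_bound (measurable_signProd.comp hT).aestronglyMeasurable 1
      (ae_of_all _ fun p => norm_signProd_le _)
  -- Max-stability replaces the two independent copies by the thinned maxima; Fubini then integrates
  -- the coins first, for fixed `ω`.
  rw [hhalf, kendallTau_eq_integral_map hM.aemeasurable, ← h.map_thinnedMax s₁ s₂,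
    integral_map hT.aemeasurable measurable_signProd.aestronglyMeasurable, integral_prod _ hint]
  let A : Set Ω := {ω | ∃ l, spectralMax ζ Y s₁ ω = spectralFun ζ Y l s₁ ω ∧
    spectralMax ζ Y s₂ ω = spectralFun ζ Y l s₂ ω}
  have hA : MeasurableSet A := by
    have : A = ⋃ l, {ω | spectralMax ζ Y s₁ ω = spectralFun ζ Y l s₁ ω} ∩
        {ω | spectralMax ζ Y s₂ ω = spectralFun ζ Y l s₂ ω} := by
      ext; simp [A]
    rw [this]
    exact MeasurableSet.iUnion fun l =>
      (measurableSet_eq_fun (h.measurable_spectralMax s₁) (h.measurable_spectralFun l s₁)).inter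
        (measurableSet_eq_fun (h.measurable_spectralMax s₂) (h.measurable_spectralFun l s₂))
  have hpA : extremalConcurrenceProb P ζ Y ![s₁, s₂] = P.real A := by
    rw [extremalConcurrenceProb]
    congr 1
    ext ω
    simp [A, Fin.forall_fin_two]
  rw [hpA, ← integral_indicator_one hA]
  refine integral_congr_ae ?_
  filter_upwards [h.ae_tendsto_zero s₁, h.ae_tendsto_zero s₂, h.ae_spectralMax_pos s₁,
    h.ae_spectralMax_pos s₂, Measure.ae_ae_of_ae_prod (h.ae_thinnedMax_ne s₁),
    Measure.ae_ae_of_ae_prod (h.ae_thinnedMax_ne s₂)] with ω h1 h2 h3 h4 h5 h6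
  refine Eq.trans ?_ (integral_sign_coinSup (fun i => h.spectralFun_nonneg i s₁ ω)
    (fun i => h.spectralFun_nonneg i s₂ ω) h1 h2 h3 h4 h5 h6).symm
  rw [indicator_apply]
  rfl

theorem theorem4 {T Ω Ω' : Type*} [MeasurableSpace Ω] [MeasurableSpace Ω']
    (P : Measure Ω) [IsProbabilityMeasure P] (P' : Measure Ω') [IsProbabilityMeasure P']
    (ζ : ℕ → Ω → ℝ) (Y : ℕ → T → Ω → ℝ) (η : T → Ω' → ℝ)
    (hη : HasSpectralRepresentation P' η P ζ Y) (s₁ s₂ : T) :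
    extremalConcurrenceProb P ζ Y ![s₁, s₂] = kendallTau P' (η s₁) (η s₂) := by
  classical
  obtain ⟨h, hmono, hlaw⟩ := hη.law
  -- If `s₁ = s₂` the finite set has one point and both indices coincide, so no case split is
  -- needed.
  let a₁ : ({s₁, s₂} : Finset T) := ⟨s₁, by simp⟩
  let a₂ : ({s₁, s₂} : Finset T) := ⟨s₂, by simp⟩
  have hpair := (hlaw {s₁, s₂}).comp (u := fun f => (f a₁, f a₂)) (by fun_prop)
  have hid : IdentDistrib (fun ω => (η s₁ ω, η s₂ ω))
      (fun ω => (h s₁ (spectralMax ζ Y s₁ ω), h s₂ (spectralMax ζ Y s₂ ω))) P' P := hpair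
  rw [hη.data.extremalConcurrenceProb_eq, hid.kendallTau_eq]
  exact (kendallTau_strictMonoOn (hmono s₁) (hmono s₂) (hη.data.ae_spectralMax_pos s₁)
    (hη.data.ae_spectralMax_pos s₂)).symm
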